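/- Let $D\ge 1$. A $C^\infty$ diffeomorphism $\Phi$ of $\mathbb R^D$ onto itself is called $\varepsilon$-distorted if $$(1+\varepsilon)^{-1}I\le (\nabla\Phi(x))^{T}\,\nabla\Phi(x)\le (1+\varepsilon)I$$ as symmetric matrices for all $x\in\mathbb R^D$. Then there is a constant $C>0$ depending only on $D$ such that the following holds for every $0<\varepsilon<C$ and every positive integer $m$. Let $\lambda>0$ be less than a small enough positive constant depending only on $\varepsilon$, $m$ and $D$, and let $\delta>0$ be less than a small enough positive constant depending only on $\lambda$, $\varepsilon$, $m$ and $D$. Let $1\le k\le D$, let $y_1,\dots,y_k$ be distinct points of $\mathbb R^D$ and let $z_1,\dots,z_k$ be distinct points of $\mathbb R^D$, with $y_1=z_1$. Assume that $$|y_i-y_j|\ge \lambda^m\,\mathrm{diam}\{y_1,\dots,y_k\},\qquad i\ne j,$$ and $$(1+\delta)^{-1}\le \frac{|z_i-z_j|}{|y_i-y_j|}\le 1+\delta,\qquad i\ne j.$$ Then there exists an $\varepsilon$-distorted diffeomorphism $\Phi:\mathbb R^D\to\mathbb R^D$ such that $\Phi(y_i)=z_i$ for $1\le i\le k$ and $$\Phi(x)=x\quad\text{for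 all } x\in\mathbb R^D \text{ with } |x-y_1|\ge \lambda^{-1/2}\,\mathrm{diam}\{y_1,\dots,y_k\}.$$ -/

import Mathlib

open scoped ContDiff Manifold MatrixOrder

/-- The Jacobian matrix of a map from `ℝ^D` to itself at `x`: the entry `(i, j)` is the partial
derivative at `x` of the `i`-th component in the direction of the `j`-th coordinate. -/
noncomputable def jacobianMatrix {D : ℕ}
    (f : EuclideanSpace ℝ (Fin D) → EuclideanSpace ℝ (Fin D)) (x : EuclideanSpace ℝ (Fin D)) :
    Matrix (Fin D) (Fin D) ℝ :=
  Matrix.of fun i j => fderiv ℝ f x (EuclideanSpace.single j 1) i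

/-- A smooth diffeomorphism `Φ` of `ℝ^D` onto itself is `ε`-distorted if
`(1 + ε)⁻¹ I ≤ (∇Φ(x))ᵀ ∇Φ(x) ≤ (1 + ε) I` for all `x`, where `A ≤ B` for symmetric matrices means
that `B - A` is positive semidefinite. -/
def IsDistorted {D : ℕ} (ε : ℝ)
    (Φ : EuclideanSpace ℝ (Fin D) ≃ₘ[ℝ] EuclideanSpace ℝ (Fin D)) : Prop :=
  ∀ x : EuclideanSpace ℝ (Fin D),
    (1 + ε)⁻¹ • (1 : Matrix (Fin D) (Fin D) ℝ) ≤ (jacobianMatrix Φ x).transpose * jacobianMatrix Φ x ∧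
    (jacobianMatrix Φ x).transpose * jacobianMatrix Φ x ≤ (1 + ε) • (1 : Matrix (Fin D) (Fin D) ℝ)

/-! Translate so that y_1 = z_1 = 0 and let d be the diameter of the y_i. By compactness, a
configuration z with almost the same mutual distances as y lies within a small multiple of d of A y
for some linear isometry A (`exists_near_linearIsometryEquiv`). The map Φ is a cut-off version of A
followed by a small correction moving each A y_i to z_i.

A can be joined to the identity only if it preserves orientation. Since k ≤ D, the y_i lie in a
proper subspace, so composing A with the reflection along a vector e orthogonal to them changes no A
y_i; either A or this composite is a product of an even number of reflections
(`IsRealizable.exists_or_mul_reflection`).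

A product of two reflections is the start of a path of isometries ending at the identity. Following
the path with a parameter g(x) that depends on log ‖x‖ gives a diffeomorphism whose derivative
differs from an isometry by O(‖∇g‖ ‖x‖). A logarithmic cutoff makes this as small as desired, at the
price of a large but scale-free ratio of outer to inner radius (`exists_log_cutoff`,
`exists_diffeomorph_twist`). That ratio depends only on ε and D, so it is below λ^(-1/2) for small
λ.

The correction is the identity plus bumps at the A y_i; the separation λ^m d keeps its derivative
small once δ is small in terms of λ (`exists_diffeomorph_local_translations`). -/

/-- The derivative of `f` distorts norms by a factor of at most `c`. -/
def DerivBilipschitz {E : Type*} [NormedAddCommGroup E] [NormedSpace ℝ E] (c : ℝ)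
    (f : E → E) : Prop :=
  ∀ x h : E, c⁻¹ * ‖h‖ ≤ ‖fderiv ℝ f x h‖ ∧ ‖fderiv ℝ f x h‖ ≤ c * ‖h‖

/-! ### Calculus of derivative distortion; perturbations of the identity -/

section General

variable {E : Type*} [NormedAddCommGroup E] [NormedSpace ℝ E]

theorem DerivBilipschitz.comp {a b : ℝ} (ha : 0 < a) {f g : E → E}
    (hf : DerivBilipschitz a f) (hg : DerivBilipschitz b g) (df : Differentiable ℝ f)
    (dg : Differentiable ℝ g) : DerivBilipschitz (a * b) (f ∘ g) := by
  intro x h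
  rw [fderiv_comp x (df _) (dg _), ContinuousLinearMap.comp_apply]
  obtain ⟨h1, h2⟩ := hf (g x) (fderiv ℝ g x h)
  obtain ⟨h3, h4⟩ := hg x h
  constructor
  · calc (a * b)⁻¹ * ‖h‖ = a⁻¹ * (b⁻¹ * ‖h‖) := by rw [mul_inv]; ring
      _ ≤ a⁻¹ * ‖fderiv ℝ g x h‖ := by gcongr
      _ ≤ _ := h1
  · calc _ ≤ a * ‖fderiv ℝ g x h‖ := h2
      _ ≤ a * (b * ‖h‖) := by gcongr
      _ = _ := by ring

theorem DerivBilipschitz.id : DerivBilipschitz 1 (fun x : E => x) := by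
  intro x h
  simp

theorem DerivBilipschitz.mono {a b : ℝ} (ha : 0 < a) (hab : a ≤ b) {f : E → E}
    (hf : DerivBilipschitz a f) : DerivBilipschitz b f := by
  intro x h
  obtain ⟨h1, h2⟩ := hf x h
  refine ⟨le_trans ?_ h1, h2.trans ?_⟩ <;> gcongr

theorem derivBilipschitz_of_near_isometry {f : E → E} {η : ℝ} (hη0 : 0 ≤ η) (hη : η < 1)
    (hf : ∀ x h : E, ∃ v : E, ‖v‖ = ‖h‖ ∧ ‖fderiv ℝ f x h - v‖ ≤ η * ‖h‖) :
    DerivBilipschitz (1 - η)⁻¹ f := by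
  intro x h
  obtain ⟨v, hv, hd⟩ := hf x h
  have h1 : ‖v‖ ≤ ‖fderiv ℝ f x h‖ + ‖fderiv ℝ f x h - v‖ := by
    have := norm_sub_norm_le v (fderiv ℝ f x h)
    rw [norm_sub_rev] at this
    linarith
  have h2 : ‖fderiv ℝ f x h‖ ≤ ‖v‖ + ‖fderiv ℝ f x h - v‖ := by
    have := norm_sub_norm_le (fderiv ℝ f x h) v
    linarith
  rw [inv_inv]
  constructor
  · nlinarith
  · have h3 : 1 + η ≤ (1 - η)⁻¹ := by
      rw [← one_div, le_div_iff₀ (by linarith)]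
      nlinarith
    calc _ ≤ (1 + η) * ‖h‖ := by rw [hv] at h2; linarith
      _ ≤ _ := by gcongr

/-- A contraction added to the identity gives a homeomorphism by the quantitative inverse function
theorem. The lower distortion bound makes each derivative injective, hence invertible in finite
dimension, so the inverse is smooth. -/
theorem exists_diffeomorph_id_add [FiniteDimensional ℝ E] {h : E → E} (hh : ContDiff ℝ ∞ h)
    {η : ℝ} (hη0 : 0 ≤ η) (hη : η < 1) (hb : ∀ x, ‖fderiv ℝ h x‖ ≤ η) :
    ∃ Φ : E ≃ₘ[ℝ] E, (∀ x, Φ x = x + h x) ∧ DerivBilipschitz (1 - η)⁻¹ Φ := by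
  have : CompleteSpace E := FiniteDimensional.complete ℝ E
  lift η to NNReal using hη0
  have hd : Differentiable ℝ h := hh.differentiable (by simp)
  have hl : LipschitzWith η h :=
    lipschitzWith_of_nnnorm_fderiv_le hd fun x => hb x
  have ha : ApproximatesLinearOn (fun x => x + h x)
      ((ContinuousLinearEquiv.refl ℝ E : E ≃L[ℝ] E) : E →L[ℝ] E) Set.univ η := by
    apply LipschitzOnWith.approximatesLinearOn
    rw [lipschitzOnWith_univ]
    convert! hl
    ext x
    simp
  have hc : Subsingleton E ∨ (η : NNReal) <
      ‖((ContinuousLinearEquiv.refl ℝ E).symm : E →L[ℝ] E)‖₊⁻¹ := by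
    rcases subsingleton_or_nontrivial E with hE | hE
    · exact Or.inl hE
    · right
      have : ‖((ContinuousLinearEquiv.refl ℝ E).symm : E →L[ℝ] E)‖₊ = 1 := by
        rw [← NNReal.coe_inj]
        exact ContinuousLinearMap.norm_id
      rw [this, inv_one]
      exact_mod_cast hη
  let e : E ≃ₜ E := ha.toHomeomorph _ hc
  have he : ∀ x, e x = x + h x := fun x => rfl
  have hes : ContDiff ℝ ∞ (fun x => x + h x) := contDiff_id.add hh
  have hder : ∀ x, HasFDerivAt (fun x => x + h x) (ContinuousLinearMap.id ℝ E + fderiv ℝ h x) x :=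
    fun x => (hasFDerivAt_id x).add (hd x).hasFDerivAt
  have hbil : DerivBilipschitz (1 - η)⁻¹ (fun x => x + h x) := by
    refine derivBilipschitz_of_near_isometry η.2 hη fun x v => ⟨v, rfl, ?_⟩
    rw [(hder x).fderiv]
    simpa using (fderiv ℝ h x).le_of_opNorm_le (hb x) v
  have hinj : ∀ x, Function.Injective (fderiv ℝ (fun x => x + h x) x) := fun x => by
    rw [injective_iff_map_eq_zero]
    intro v hv
    have := (hbil x v).1
    rw [hv, norm_zero, inv_inv] at this
    by_contra hne
    have := norm_pos_iff.2 hne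
    nlinarith
  let f' : E → E ≃L[ℝ] E := fun x =>
    (LinearEquiv.ofInjectiveEndo (fderiv ℝ (fun x => x + h x) x : E →ₗ[ℝ] E)
      (hinj x)).toContinuousLinearEquiv
  have hf' : ∀ x, HasFDerivAt e (f' x : E →L[ℝ] E) x := fun x => by
    have h1 := (hes.differentiable (by simp) x).hasFDerivAt
    have h2 : (f' x : E →L[ℝ] E) = fderiv ℝ (fun x => x + h x) x := by
      ext v
      rfl
    rw [h2]
    exact h1
  have hsymm := e.contDiff_symm hf' hes
  exact ⟨⟨e.toEquiv, hes.contMDiff, hsymm.contMDiff⟩, he, hbil⟩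

theorem exists_diffeomorph_conj_translation (Φ : E ≃ₘ[ℝ] E) {c : ℝ} (hΦ : DerivBilipschitz c Φ)
    (a : E) : ∃ Ψ : E ≃ₘ[ℝ] E, DerivBilipschitz c Ψ ∧ ∀ x, Ψ x = Φ (x - a) + a := by
  let e : E ≃ E :=
    { toFun := fun x => Φ (x - a) + a
      invFun := fun x => Φ.symm (x - a) + a
      left_inv := fun x => by simp
      right_inv := fun x => by simp }
  have h1 : ContDiff ℝ ∞ fun x => Φ (x - a) + a :=
    (Φ.contDiff.comp (contDiff_id.sub contDiff_const)).add contDiff_const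
  have h2 : ContDiff ℝ ∞ fun x => Φ.symm (x - a) + a :=
    (Φ.symm.contDiff.comp (contDiff_id.sub contDiff_const)).add contDiff_const
  refine ⟨⟨e, h1.contMDiff, h2.contMDiff⟩, fun x h => ?_, fun x => rfl⟩
  change _ ≤ ‖fderiv ℝ (fun x => Φ (x - a) + a) x h‖ ∧ ‖fderiv ℝ (fun x => Φ (x - a) + a) x h‖ ≤ _
  rw [fderiv_add_const, fderiv_comp_sub]
  exact hΦ (x - a) h

end General

/-! ### Twisting by a radially varying isometry -/

section Twist

variable {E : Type*} [NormedAddCommGroup E] [NormedSpace ℝ E]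

/-- As g is radial and each A t preserves norms, g is constant along orbits and x ↦ B (g x) x is the
inverse. The derivative at x is the isometry A (g x) plus a rank-one term of size at most K ‖∇g‖
‖x‖. -/
theorem exists_diffeomorph_twist {A B : ℝ → E →L[ℝ] E} (hA : ContDiff ℝ ∞ A)
    (hB : ContDiff ℝ ∞ B) (hAB : ∀ t x, A t (B t x) = x) (hBA : ∀ t x, B t (A t x) = x)
    (hAn : ∀ t x, ‖A t x‖ = ‖x‖) {K η : ℝ} (hK : ∀ t, ‖deriv A t‖ ≤ K) {g : E → ℝ}
    (hg : ContDiff ℝ ∞ g) (hrad : ∀ x y, ‖x‖ = ‖y‖ → g x = g y)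
    (hgη : ∀ x, ‖fderiv ℝ g x‖ * ‖x‖ ≤ η) (hη : K * η < 1) :
    ∃ Φ : E ≃ₘ[ℝ] E, (∀ x, Φ x = A (g x) x) ∧ DerivBilipschitz (1 - K * η)⁻¹ Φ := by
  have hK0 : 0 ≤ K := (norm_nonneg _).trans (hK 0)
  have hη0 : 0 ≤ η := le_trans (by positivity) (hgη 0)
  have hBn : ∀ t x, ‖B t x‖ = ‖x‖ := fun t x => by rw [← hAn t (B t x), hAB]
  have sA : ContDiff ℝ ∞ fun x => A (g x) x := (hA.comp hg).clm_apply contDiff_id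
  have sB : ContDiff ℝ ∞ fun x => B (g x) x := (hB.comp hg).clm_apply contDiff_id
  let e : E ≃ E :=
    { toFun := fun x => A (g x) x
      invFun := fun x => B (g x) x
      left_inv := fun x => by
        simp only
        rw [hrad (A (g x) x) x (hAn _ _), hBA]
      right_inv := fun x => by
        simp only
        rw [hrad (B (g x) x) x (hBn _ _), hAB] }
  refine ⟨⟨e, sA.contMDiff, sB.contMDiff⟩, fun x => rfl, ?_⟩
  refine derivBilipschitz_of_near_isometry (by positivity) hη fun x h =>
    ⟨A (g x) h, hAn _ _, ?_⟩
  have h1 : HasFDerivAt (fun x => A (g x)) _ x :=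
    ((hA.differentiable (by simp) (g x)).hasDerivAt.hasFDerivAt.comp x
      (hg.differentiable (by simp) x).hasFDerivAt)
  have h2 := h1.clm_apply (hasFDerivAt_id x)
  have h3 : fderiv ℝ (fun x => A (g x) x) x h =
      A (g x) h + fderiv ℝ g x h • deriv A (g x) x := by
    have := h2.fderiv
    simp only [id] at this
    rw [this]
    simp
  change ‖fderiv ℝ (fun x => A (g x) x) x h - A (g x) h‖ ≤ _
  rw [h3, add_sub_cancel_left, norm_smul]
  calc ‖fderiv ℝ g x h‖ * ‖deriv A (g x) x‖
      ≤ (‖fderiv ℝ g x‖ * ‖h‖) * (K * ‖x‖) := by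
        gcongr
        · exact ContinuousLinearMap.le_opNorm _ _
        · exact ContinuousLinearMap.le_of_opNorm_le _ (hK _) _
    _ = K * (‖fderiv ℝ g x‖ * ‖x‖) * ‖h‖ := by ring
    _ ≤ K * η * ‖h‖ := by gcongr; exact hgη x

end Twist

/-! ### The logarithmic cutoff -/

theorem Real.exists_bound_deriv_smoothTransition :
    ∃ M : ℝ, 0 < M ∧ ∀ t, |deriv Real.smoothTransition t| ≤ M := by
  have hc : Continuous (deriv Real.smoothTransition) :=
    (Real.smoothTransition.contDiff (n := 1)).continuous_deriv le_rfl
  obtain ⟨M, hM⟩ := (isCompact_Icc (a := (0 : ℝ)) (b := 1)).exists_bound_of_continuousOn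
    hc.continuousOn
  refine ⟨max M 1, by positivity, fun t => ?_⟩
  by_cases ht : t ∈ Set.Icc (0 : ℝ) 1
  · exact (hM t ht).trans (le_max_left _ _)
  · have : deriv Real.smoothTransition t = 0 := by
      rw [Set.mem_Icc, not_and_or, not_le, not_le] at ht
      rcases ht with ht | ht
      · have : Real.smoothTransition =ᶠ[nhds t] fun _ => 0 := by
          filter_upwards [gt_mem_nhds ht] with s hs
          exact Real.smoothTransition.zero_of_nonpos (le_of_lt hs)
        rw [this.deriv_eq, deriv_const]
      · have : Real.smoothTransition =ᶠ[nhds t] fun _ => 1 := by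
          filter_upwards [lt_mem_nhds ht] with s hs
          exact Real.smoothTransition.one_of_one_le (le_of_lt hs)
        rw [this.deriv_eq, deriv_const]
    rw [this, abs_zero]
    positivity

section Radial

variable {E : Type*} [NormedAddCommGroup E] [InnerProductSpace ℝ E]

/-- A smooth radial cutoff in the logarithmic scale: its gradient is `O(1 / (L ‖x‖))`. -/
theorem exists_log_cutoff {η : ℝ} (hη : 0 < η) :
    ∃ L : ℝ, 1 ≤ L ∧ ∀ R : ℝ, 0 < R → ∃ g : E → ℝ, ContDiff ℝ ∞ g ∧
      (∀ x y, ‖x‖ = ‖y‖ → g x = g y) ∧ (∀ x, ‖fderiv ℝ g x‖ * ‖x‖ ≤ η) ∧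
      (∀ x, ‖x‖ ≤ R → g x = 0) ∧ (∀ x, L * R ≤ ‖x‖ → g x = 1) := by
  obtain ⟨M, hM0, hM⟩ := Real.exists_bound_deriv_smoothTransition
  set a : ℝ := M / η with ha
  have ha0 : 0 < a := by positivity
  refine ⟨Real.exp a, Real.one_le_exp ha0.le, fun R hR => ?_⟩
  -- This is log(‖x‖ / R) / a, written with squares to be visibly smooth off the origin. It runs
  -- from 0 to 1 as ‖x‖ goes from R to exp(a) R, and ‖∇q‖ ‖x‖ = 1 / a.
  let q : E → ℝ := fun x => Real.log (‖x‖ ^ 2 / R ^ 2) / (2 * a)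
  have hq : ∀ x, ‖x‖ ≤ R → q x ≤ 0 := fun x hx => by
    have : Real.log (‖x‖ ^ 2 / R ^ 2) ≤ 0 := by
      apply Real.log_nonpos (by positivity)
      rw [div_le_one (by positivity)]
      gcongr
    exact div_nonpos_of_nonpos_of_nonneg this (by positivity)
  have h0 : ∀ x, ‖x‖ ≤ R → Real.smoothTransition (q x) = 0 := fun x hx =>
    Real.smoothTransition.zero_of_nonpos (hq x hx)
  have hqd : ∀ x : E, x ≠ 0 → HasFDerivAt q ((2 * a)⁻¹ •
      ((‖x‖ ^ 2 / R ^ 2)⁻¹ • ((R ^ 2)⁻¹ • (2 • innerSL ℝ x)))) x := fun x hx => by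
    have hx' := norm_pos_iff.2 hx
    have h1 : HasFDerivAt (fun x : E => ‖x‖ ^ 2) _ x := (hasStrictFDerivAt_norm_sq x).hasFDerivAt
    have h2 : HasFDerivAt (fun x : E => ‖x‖ ^ 2 / R ^ 2) ((R ^ 2)⁻¹ • (2 • innerSL ℝ x)) x := by
      simp only [div_eq_mul_inv]
      exact h1.mul_const _
    have h3 := h2.log (by positivity)
    simp only [q, div_eq_mul_inv _ (2 * a)]
    exact h3.mul_const _
  have hqs : ∀ x : E, x ≠ 0 → ContDiffAt ℝ ∞ q x := fun x hx => by
    have hx' := norm_pos_iff.2 hx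
    have : ContDiffAt ℝ ∞ (fun x : E => ‖x‖ ^ 2 / R ^ 2) x :=
      ((contDiff_norm_sq ℝ).div_const _).contDiffAt
    exact (this.log (by positivity)).div_const _
  refine ⟨fun x => Real.smoothTransition (q x), ?_, ?_, ?_, h0, ?_⟩
  · rw [contDiff_iff_contDiffAt]
    intro x
    by_cases hx : x = 0
    · have : (fun x => Real.smoothTransition (q x)) =ᶠ[nhds x] fun _ => 0 := by
        filter_upwards [Metric.ball_mem_nhds x hR] with y hy
        apply h0
        subst hx
        simpa using (Metric.mem_ball.1 hy).le
      exact contDiffAt_const.congr_of_eventuallyEq this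
    · exact Real.smoothTransition.contDiffAt.comp x (hqs x hx)
  · intro x y hxy
    simp only [q, hxy]
  · intro x
    by_cases hx : x = 0
    · subst hx; simpa using hη.le
    have hx' := norm_pos_iff.2 hx
    have hs : HasDerivAt Real.smoothTransition (deriv Real.smoothTransition (q x)) (q x) :=
      ((Real.smoothTransition.contDiff (n := 1)).differentiable (by simp) _).hasDerivAt
    have h1 := hs.comp_hasFDerivAt x (hqd x hx)
    have h2 : fderiv ℝ (fun x => Real.smoothTransition (q x)) x = _ := h1.fderiv
    rw [h2, norm_smul, norm_smul, norm_smul, norm_smul, ← Nat.cast_smul_eq_nsmul ℝ, norm_smul,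
      innerSL_apply_norm]
    simp only [Real.norm_eq_abs]
    rw [abs_of_pos (show 0 < (2 * a)⁻¹ by positivity),
      abs_of_pos (show 0 < (‖x‖ ^ 2 / R ^ 2)⁻¹ by positivity),
      abs_of_pos (show 0 < (R ^ 2)⁻¹ by positivity)]
    calc _ = |deriv Real.smoothTransition (q x)| / a := by
          norm_num
          field_simp
      _ ≤ M / a := by gcongr; exact hM _
      _ = η := by rw [ha]; field_simp
  · intro x hx
    apply Real.smoothTransition.one_of_one_le
    rw [one_le_div (by positivity), Real.le_log_iff_exp_le]
    · rw [le_div_iff₀ (by positivity), two_mul, Real.exp_add]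
      calc Real.exp a * Real.exp a * R ^ 2 = (Real.exp a * R) ^ 2 := by ring
        _ ≤ _ := by gcongr
    · have : 0 < ‖x‖ := lt_of_lt_of_le (by positivity) hx
      positivity

end Radial

/-! ### Realizing products of reflections -/

section Reflections

variable {E : Type*} [NormedAddCommGroup E] [InnerProductSpace ℝ E]

open scoped RealInnerProductSpace

theorem reflection_orthogonal_singleton_apply (w x : E) :
    (ℝ ∙ w)ᗮ.reflection x = x - (2 * ⟪w, x⟫ / ‖w‖ ^ 2) • w := by
  rw [Submodule.reflection_orthogonal_apply, Submodule.reflection_singleton_apply, neg_sub,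
    two_smul, ← add_smul]
  congr 2
  simp only [RCLike.ofReal_real_eq_id, id]
  ring

theorem reflection_orthogonal_singleton_smul {a : ℝ} (ha : a ≠ 0) (w : E) :
    (ℝ ∙ (a • w))ᗮ.reflection = (ℝ ∙ w)ᗮ.reflection := by
  have : (ℝ ∙ (a • w)) = ℝ ∙ w := Submodule.span_singleton_smul_eq (IsUnit.mk0 a ha) w
  ext x
  rw [reflection_orthogonal_singleton_apply, reflection_orthogonal_singleton_apply, norm_smul,
    inner_smul_left, smul_smul]
  congr 2
  simp only [mul_pow, Real.norm_eq_abs, sq_abs, conj_trivial]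
  field_simp

theorem LinearIsometryEquiv.mul_reflection_singleton (B : E ≃ₗᵢ[ℝ] E) (e : E) :
    B * (ℝ ∙ e)ᗮ.reflection = (ℝ ∙ (B e))ᗮ.reflection * B := by
  ext x
  simp only [LinearIsometryEquiv.coe_mul, Function.comp_apply,
    reflection_orthogonal_singleton_apply, map_sub, map_smul, LinearIsometryEquiv.inner_map_map,
    LinearIsometryEquiv.norm_map]

theorem reflection_mul_self (K : Submodule ℝ E) [K.HasOrthogonalProjection] :
    K.reflection * K.reflection = 1 := by
  ext x
  simp

theorem contDiff_reflection_orthogonal_singleton {w : ℝ → E} (hw : ContDiff ℝ ∞ w)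
    (h0 : ∀ t, w t ≠ 0) :
    ContDiff ℝ ∞ fun t => (((ℝ ∙ w t)ᗮ.reflection : E ≃L[ℝ] E) : E →L[ℝ] E) := by
  have : (fun t => (((ℝ ∙ w t)ᗮ.reflection : E ≃L[ℝ] E) : E →L[ℝ] E)) = fun t =>
      ContinuousLinearMap.id ℝ E - (2 / ‖w t‖ ^ 2) • (innerSL ℝ (w t)).smulRight (w t) := by
    ext t x
    refine (reflection_orthogonal_singleton_apply (w t) x).trans ?_
    simp [smul_smul]
    congr 1
    ring
  rw [this]
  refine contDiff_const.sub (ContDiff.smul (contDiff_const.div (hw.norm_sq ℝ) ?_) ?_)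
  · intro t
    have := norm_pos_iff.2 (h0 t)
    positivity
  · exact ((innerSL ℝ).contDiff.comp hw).smulRight hw

theorem norm_deriv_reflection_le {w : ℝ → E} {w' : E} {t : ℝ} (hw : HasDerivAt w w' t)
    (hw' : ‖w'‖ ≤ 2) (hn : 1 / 2 ≤ ‖w t‖) (y : E) :
    ‖deriv (fun s => (ℝ ∙ w s)ᗮ.reflection y) t‖ ≤ 32 * ‖y‖ := by
  simp only [reflection_orthogonal_singleton_apply]
  have hpos : 0 < ‖w t‖ := by linarith
  have h1 : HasDerivAt (fun s => 2 * ⟪w s, y⟫) (2 * ⟪w', y⟫) t := by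
    have := (hw.inner ℝ (hasDerivAt_const t y)).const_mul 2
    simpa using this
  have h2 : HasDerivAt (fun s => ‖w s‖ ^ 2) (2 * ⟪w t, w'⟫) t := hw.norm_sq
  have h3 : deriv (fun s => y - (2 * ⟪w s, y⟫ / ‖w s‖ ^ 2) • w s) t = _ :=
    (((h1.div h2 (by positivity)).smul hw).const_sub y).deriv
  simp only [Pi.div_apply] at h3
  rw [h3, norm_neg]
  have i1 : |⟪w', y⟫| ≤ 2 * ‖y‖ := (abs_real_inner_le_norm _ _).trans (by gcongr)
  have i2 : |⟪w t, y⟫| ≤ ‖w t‖ * ‖y‖ := abs_real_inner_le_norm _ _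
  have i3 : |⟪w t, w'⟫| ≤ ‖w t‖ * 2 := (abs_real_inner_le_norm _ _).trans (by gcongr)
  have e1 : |2 * ⟪w t, y⟫ / ‖w t‖ ^ 2| ≤ 4 * ‖y‖ := by
    rw [abs_div, abs_of_pos (show 0 < ‖w t‖ ^ 2 by positivity), div_le_iff₀ (by positivity),
      abs_mul, abs_two]
    calc 2 * |⟪w t, y⟫| ≤ 2 * (‖w t‖ * ‖y‖) := by gcongr
      _ = 4 * ‖y‖ * ((1 / 2) * ‖w t‖) := by ring
      _ ≤ 4 * ‖y‖ * (‖w t‖ * ‖w t‖) := by gcongr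
      _ = _ := by ring
  have e2 : |(2 * ⟪w', y⟫ * ‖w t‖ ^ 2 - 2 * ⟪w t, y⟫ * (2 * ⟪w t, w'⟫)) / (‖w t‖ ^ 2) ^ 2| * ‖w t‖
      ≤ 24 * ‖y‖ := by
    rw [abs_div, abs_of_pos (show 0 < (‖w t‖ ^ 2) ^ 2 by positivity), div_mul_eq_mul_div,
      div_le_iff₀ (by positivity)]
    have : |2 * ⟪w', y⟫ * ‖w t‖ ^ 2 - 2 * ⟪w t, y⟫ * (2 * ⟪w t, w'⟫)| ≤ 12 * ‖y‖ * ‖w t‖ ^ 2 := by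
      refine (abs_sub _ _).trans ?_
      simp only [abs_mul, abs_two, abs_pow, abs_norm]
      calc _ ≤ 2 * (2 * ‖y‖) * ‖w t‖ ^ 2 + 2 * (‖w t‖ * ‖y‖) * (2 * (‖w t‖ * 2)) := by gcongr
        _ = _ := by ring
    calc _ ≤ 12 * ‖y‖ * ‖w t‖ ^ 2 * ‖w t‖ := by gcongr
      _ = 24 * ‖y‖ * (‖w t‖ ^ 2 * ((1 / 2) * ‖w t‖)) := by ring
      _ ≤ 24 * ‖y‖ * (‖w t‖ ^ 2 * (‖w t‖ * ‖w t‖)) := by gcongr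
      _ = _ := by ring
  refine (norm_add_le _ _).trans ?_
  rw [norm_smul, norm_smul, Real.norm_eq_abs, Real.norm_eq_abs]
  have e3 : |2 * ⟪w t, y⟫ / ‖w t‖ ^ 2| * ‖w'‖ ≤ 4 * ‖y‖ * 2 := by gcongr
  linarith

/-- The linear isometry `A` agrees on any given ball with a diffeomorphism of derivative
distortion at most `c` which is the identity outside of the ball dilated by `Λ`. -/
def IsRealizable (c Λ : ℝ) (A : E ≃ₗᵢ[ℝ] E) : Prop :=
  ∀ R : ℝ, 0 < R → ∃ Φ : E ≃ₘ[ℝ] E, DerivBilipschitz c Φ ∧ (∀ x, ‖x‖ ≤ R → Φ x = A x) ∧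
    ∀ x, Λ * R ≤ ‖x‖ → Φ x = x

theorem IsRealizable.one {Λ : ℝ} : IsRealizable 1 Λ (1 : E ≃ₗᵢ[ℝ] E) := fun _ _ =>
  ⟨Diffeomorph.refl _ _ _, DerivBilipschitz.id, fun _ _ => rfl, fun _ _ => rfl⟩

theorem IsRealizable.mono {a b Λ : ℝ} (ha : 0 < a) (hab : a ≤ b) {A : E ≃ₗᵢ[ℝ] E}
    (h : IsRealizable a Λ A) : IsRealizable b Λ A := fun R hR =>
  let ⟨Φ, h1, h2⟩ := h R hR
  ⟨Φ, h1.mono ha hab, h2⟩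

/-- Isometries preserve the ball of radius R, so both factors use the same R and Λ does not grow
under products; only the distortions multiply. -/
theorem IsRealizable.mul {a b Λ : ℝ} (ha : 0 < a) {A B : E ≃ₗᵢ[ℝ] E}
    (hA : IsRealizable a Λ A) (hB : IsRealizable b Λ B) : IsRealizable (a * b) Λ (A * B) := by
  intro R hR
  obtain ⟨Φ, h1, h2, h3⟩ := hA R hR
  obtain ⟨Ψ, k1, k2, k3⟩ := hB R hR
  refine ⟨Ψ.trans Φ, ?_, ?_, ?_⟩
  · rw [Diffeomorph.coe_trans]
    exact h1.comp ha k1 (Φ.contDiff.differentiable (by simp))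
      (Ψ.contDiff.differentiable (by simp))
  · intro x hx
    rw [Diffeomorph.coe_trans, Function.comp_apply, k2 x hx, h2 _ (by simpa using hx)]
    rfl
  · intro x hx
    rw [Diffeomorph.coe_trans, Function.comp_apply, k3 x hx, h3 x hx]

theorem IsRealizable.reflection_mul_reflection_of_unit {η L : ℝ} (hη : 32 * η < 1)
    (hg : ∀ R : ℝ, 0 < R → ∃ g : E → ℝ, ContDiff ℝ ∞ g ∧
      (∀ x y, ‖x‖ = ‖y‖ → g x = g y) ∧ (∀ x, ‖fderiv ℝ g x‖ * ‖x‖ ≤ η) ∧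
      (∀ x, ‖x‖ ≤ R → g x = 0) ∧ (∀ x, L * R ≤ ‖x‖ → g x = 1))
    {u v : E} (hu : ‖u‖ = 1) (hv : ‖v‖ = 1) (huv : 0 ≤ ⟪u, v⟫) :
    IsRealizable (1 - 32 * η)⁻¹ L ((ℝ ∙ u)ᗮ.reflection * (ℝ ∙ v)ᗮ.reflection) := by
  intro R hR
  obtain ⟨g, gs, grad, gη, g0, g1⟩ := hg R hR
  -- Moving u to v along a line deforms the product of the two reflections into the square of the
  -- second, which is the identity. The sign of the inner product keeps w away from 0 for every real
  -- t.
  let w : ℝ → E := fun t => u + t • (v - u)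
  have hws : ContDiff ℝ ∞ w := contDiff_const.add (contDiff_id.smul contDiff_const)
  have hwd : ∀ t, HasDerivAt w (v - u) t := fun t => by
    have := ((hasDerivAt_id t).smul_const (v - u)).const_add u
    rwa [one_smul] at this
  have hd : ‖v - u‖ ≤ 2 := (norm_sub_le _ _).trans (by rw [hu, hv]; norm_num)
  have hn : ∀ t, 1 / 2 ≤ ‖w t‖ := fun t => by
    have hc : ⟪u, v⟫ ≤ 1 := by simpa [hu, hv] using real_inner_le_norm u v
    have h1 : ‖w t‖ ^ 2 = 1 - 2 * (t * (1 - t)) * (1 - ⟪u, v⟫) := by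
      simp only [w]
      rw [← real_inner_self_eq_norm_sq]
      simp only [inner_add_left, inner_add_right, inner_smul_left, inner_smul_right,
        inner_sub_left, inner_sub_right, real_inner_self_eq_norm_sq, hu, hv, conj_trivial,
        real_inner_comm u v]
      ring
    have h2 : (1 / 2 : ℝ) ^ 2 ≤ ‖w t‖ ^ 2 := by
      rw [h1]
      nlinarith [sq_nonneg (t - 1 / 2), mul_nonneg (sq_nonneg (t - 1 / 2)) (sub_nonneg.2 hc)]
    exact le_of_sq_le_sq h2 (norm_nonneg _)
  have hw0 : ∀ t, w t ≠ 0 := fun t h => by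
    have := hn t
    rw [h, norm_zero] at this
    norm_num at this
  let T : ℝ → E →L[ℝ] E := fun t => (((ℝ ∙ w t)ᗮ.reflection : E ≃L[ℝ] E) : E →L[ℝ] E)
  let S : E →L[ℝ] E := (((ℝ ∙ v)ᗮ.reflection : E ≃L[ℝ] E) : E →L[ℝ] E)
  have hT : ContDiff ℝ ∞ T := contDiff_reflection_orthogonal_singleton hws hw0
  have hTT : ∀ t x, T t (T t x) = x := fun t x =>
    Submodule.reflection_reflection (ℝ ∙ w t)ᗮ x
  have hSS : ∀ x, S (S x) = x := fun x => Submodule.reflection_reflection (ℝ ∙ v)ᗮ x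
  have hTn : ∀ t x, ‖T t x‖ = ‖x‖ := fun t x => (ℝ ∙ w t)ᗮ.reflection.norm_map x
  have hSn : ∀ x, ‖S x‖ = ‖x‖ := fun x => (ℝ ∙ v)ᗮ.reflection.norm_map x
  have hA : ContDiff ℝ ∞ fun t => (T t).comp S := hT.clm_comp contDiff_const
  have hB : ContDiff ℝ ∞ fun t => S.comp (T t) := contDiff_const.clm_comp hT
  obtain ⟨Φ, h1, h2⟩ := exists_diffeomorph_twist hA hB (K := 32) (η := η)
    (fun t x => by simp [hTT, hSS]) (fun t x => by simp [hTT, hSS])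
    (fun t x => by simp [hTn, hSn]) (fun t => by
      refine ContinuousLinearMap.opNorm_le_bound _ (by norm_num) fun x => ?_
      have e1 := ((hA.differentiable (by simp) t).hasDerivAt.clm_apply (hasDerivAt_const t x))
      have e2 : deriv (fun t => (T t).comp S) t x = deriv (fun t => T t (S x)) t := by
        have := e1.deriv
        simp only [map_zero, add_zero] at this
        exact this.symm
      rw [e2, ← hSn x]
      exact norm_deriv_reflection_le (hwd t) hd (hn t) (S x)) gs grad gη hη
  refine ⟨Φ, h2, fun x hx => ?_, fun x hx => ?_⟩
  · rw [h1, g0 x hx]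
    change (ℝ ∙ w 0)ᗮ.reflection ((ℝ ∙ v)ᗮ.reflection x) = _
    have : w 0 = u := by simp [w]
    rw [this]
    rfl
  · rw [h1, g1 x hx]
    change (ℝ ∙ w 1)ᗮ.reflection ((ℝ ∙ v)ᗮ.reflection x) = _
    have : w 1 = v := by simp [w]
    rw [this, Submodule.reflection_reflection]

theorem IsRealizable.exists_reflection_mul_reflection {c : ℝ} (hc : 1 < c) :
    ∃ Λ : ℝ, 1 ≤ Λ ∧ ∀ u v : E, u ≠ 0 → v ≠ 0 →
      IsRealizable c Λ ((ℝ ∙ u)ᗮ.reflection * (ℝ ∙ v)ᗮ.reflection) := by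
  have hc' : c⁻¹ < 1 := inv_lt_one_of_one_lt₀ hc
  have hc0 : 0 < c⁻¹ := by positivity
  obtain ⟨L, hL, hg⟩ := exists_log_cutoff (E := E) (η := (1 - c⁻¹) / 32) (by linarith)
  refine ⟨L, hL, fun u v hu hv => ?_⟩
  have key : ∀ a b : ℝ, a ≠ 0 → b ≠ 0 → ‖a • u‖ = 1 → ‖b • v‖ = 1 → 0 ≤ ⟪a • u, b • v⟫ →
      IsRealizable c L ((ℝ ∙ u)ᗮ.reflection * (ℝ ∙ v)ᗮ.reflection) := by
    intro a b ha hb h1 h2 h3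
    have := IsRealizable.reflection_mul_reflection_of_unit (by linarith) hg h1 h2 h3
    rw [reflection_orthogonal_singleton_smul ha, reflection_orthogonal_singleton_smul hb] at this
    convert this using 1
    rw [← inv_inv c, inv_inv c⁻¹]
    ring_nf
  -- Reflections ignore rescaling of the vector, so u and v may be normalized and the sign of v
  -- chosen to make the inner product nonnegative.
  have hu' := norm_ne_zero_iff.2 hu
  have hv' := norm_ne_zero_iff.2 hv
  have hun : ‖(‖u‖⁻¹ : ℝ) • u‖ = 1 := by rw [norm_smul, norm_inv, norm_norm, inv_mul_cancel₀ hu']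
  have hvn : ‖(‖v‖⁻¹ : ℝ) • v‖ = 1 := by rw [norm_smul, norm_inv, norm_norm, inv_mul_cancel₀ hv']
  rcases le_total 0 ⟪(‖u‖⁻¹ : ℝ) • u, (‖v‖⁻¹ : ℝ) • v⟫ with h | h
  · exact key _ _ (inv_ne_zero hu') (inv_ne_zero hv') hun hvn h
  · refine key _ (-‖v‖⁻¹) (inv_ne_zero hu') (neg_ne_zero.2 (inv_ne_zero hv')) hun ?_ ?_
    · rw [neg_smul, norm_neg, hvn]
    · rw [neg_smul, inner_neg_right]
      linarith

/-- Every linear isometry is realizable, up to composition with one given reflection. -/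
theorem IsRealizable.exists_or_mul_reflection [FiniteDimensional ℝ E] {c : ℝ} (hc : 1 < c) :
    ∃ Λ : ℝ, 1 ≤ Λ ∧ ∀ e : E, e ≠ 0 → ∀ A : E ≃ₗᵢ[ℝ] E,
      IsRealizable (c ^ Module.finrank ℝ E) Λ A ∨
        IsRealizable (c ^ Module.finrank ℝ E) Λ (A * (ℝ ∙ e)ᗮ.reflection) := by
  obtain ⟨Λ, hΛ, H⟩ := IsRealizable.exists_reflection_mul_reflection (E := E) hc
  refine ⟨Λ, hΛ, fun e he A => ?_⟩
  have main : ∀ l : List E,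
      IsRealizable (c ^ l.length) Λ (l.map fun v => (ℝ ∙ v)ᗮ.reflection).prod ∨
        IsRealizable (c ^ l.length) Λ
          ((l.map fun v => (ℝ ∙ v)ᗮ.reflection).prod * (ℝ ∙ e)ᗮ.reflection) := by
    intro l
    induction l with
    | nil => left; simpa using IsRealizable.one
    | cons u l ih =>
      simp only [List.map_cons, List.prod_cons, List.length_cons]
      set P := (l.map fun v => (ℝ ∙ v)ᗮ.reflection).prod
      by_cases hu : u = 0
      · have h1 : (ℝ ∙ u)ᗮ.reflection = 1 := by
          ext x
          rw [reflection_orthogonal_singleton_apply, hu, smul_zero, sub_zero]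
          rfl
        rw [h1, one_mul]
        have h2 : c ^ l.length ≤ c ^ (l.length + 1) := pow_le_pow_right₀ hc.le (by simp)
        exact ih.imp (IsRealizable.mono (by positivity) h2) (IsRealizable.mono (by positivity) h2)
      -- Conjugation turns B followed on the right by the reflection along e into the reflection
      -- along B e followed on the right by B. This supplies a partner for the reflection along u,
      -- so each added reflection switches the alternative and costs one factor c.
      · have step : ∀ B : E ≃ₗᵢ[ℝ] E, IsRealizable (c ^ l.length) Λ B →
            IsRealizable (c ^ (l.length + 1)) Λ
              ((ℝ ∙ u)ᗮ.reflection * (B * (ℝ ∙ e)ᗮ.reflection)) := by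
          intro B hB
          rw [B.mul_reflection_singleton, ← mul_assoc, pow_succ']
          exact (H u (B e) hu (by simpa using he)).mul (by positivity) hB
        rcases ih with h | h
        · right
          rw [mul_assoc]
          exact step _ h
        · left
          have := step _ h
          rwa [mul_assoc P, reflection_mul_self, mul_one] at this
  obtain ⟨l, hl, rfl⟩ := A.reflections_generate_dim
  have h2 : c ^ l.length ≤ c ^ Module.finrank ℝ E := pow_le_pow_right₀ hc.le hl
  exact (main l).imp (IsRealizable.mono (by positivity) h2) (IsRealizable.mono (by positivity) h2)

/-- One of the k ≤ dim E vectors is zero, so the others span a proper subspace. -/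
theorem exists_ne_zero_orthogonal {k : ℕ} (hk : k ≤ Module.finrank ℝ E) {y : Fin k → E}
    {i₀ : Fin k} (hy : y i₀ = 0) : ∃ e : E, e ≠ 0 ∧ ∀ i, ⟪e, y i⟫ = 0 := by
  classical
  let s : Finset E := (Finset.univ.erase i₀).image y
  have hcard : s.card < Module.finrank ℝ E := by
    have h1 : s.card ≤ (Finset.univ.erase i₀).card := Finset.card_image_le
    rw [Finset.card_erase_of_mem (Finset.mem_univ _), Finset.card_univ, Fintype.card_fin] at h1
    have := i₀.pos
    omega
  let W : Submodule ℝ E := Submodule.span ℝ (s : Set E)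
  have hW : W ≠ ⊤ := fun h => by
    have h1 : Module.finrank ℝ W ≤ s.card := finrank_span_finset_le_card s
    rw [h, finrank_top] at h1
    omega
  have hW' : Wᗮ ≠ ⊥ := fun h => hW (Submodule.orthogonal_eq_bot_iff.1 h)
  obtain ⟨e, he, he0⟩ := Submodule.exists_mem_ne_zero_of_ne_bot hW'
  refine ⟨e, he0, fun i => ?_⟩
  by_cases hi : i = i₀
  · rw [hi, hy, inner_zero_right]
  · refine (Submodule.mem_orthogonal' _ _).1 he _ (Submodule.subset_span ?_)
    exact Finset.mem_coe.2 (Finset.mem_image_of_mem _ (by simp [hi]))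

end Reflections

/-! ### Almost congruent configurations -/

section NearIsometry

variable {E : Type*} [NormedAddCommGroup E] [InnerProductSpace ℝ E] [FiniteDimensional ℝ E]

open scoped RealInnerProductSpace
open Filter Topology

/-- By polarization the Gram matrices agree, so sending each combination of the y i to the same
combination of the z i is a well-defined isometry on their span, which extends to E. -/
theorem exists_linearIsometryEquiv_of_norm_eq {ι : Type*} [Fintype ι] {y z : ι → E}
    (h0 : ∀ i, ‖z i‖ = ‖y i‖) (h : ∀ i j, ‖z i - z j‖ = ‖y i - y j‖) :
    ∃ A : E ≃ₗᵢ[ℝ] E, ∀ i, A (y i) = z i := by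
  classical
  have hin : ∀ i j, ⟪z i, z j⟫ = ⟪y i, y j⟫ := fun i j => by
    rw [real_inner_eq_norm_mul_self_add_norm_mul_self_sub_norm_sub_mul_self_div_two,
      real_inner_eq_norm_mul_self_add_norm_mul_self_sub_norm_sub_mul_self_div_two, h0, h0, h]
  let f : (ι → ℝ) →ₗ[ℝ] E := Fintype.linearCombination ℝ y
  let g : (ι → ℝ) →ₗ[ℝ] E := Fintype.linearCombination ℝ z
  have hfg : ∀ c, ‖g c‖ = ‖f c‖ := fun c => by
    rw [← sq_eq_sq₀ (norm_nonneg _) (norm_nonneg _), ← real_inner_self_eq_norm_sq,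
      ← real_inner_self_eq_norm_sq]
    simp only [f, g, Fintype.linearCombination_apply, sum_inner, inner_sum, inner_smul_left,
      inner_smul_right, hin]
  obtain ⟨s, hs⟩ := f.rangeRestrict.exists_rightInverse_of_surjective f.range_rangeRestrict
  have hs' : ∀ x : LinearMap.range f, f (s x) = x := fun x =>
    congrArg Subtype.val (LinearMap.congr_fun hs x)
  let L : LinearMap.range f →ₗᵢ[ℝ] E :=
    ⟨g ∘ₗ s, fun x => by rw [LinearMap.comp_apply, hfg, hs', Submodule.coe_norm]⟩
  refine ⟨L.extend.toLinearIsometryEquiv rfl, fun i => ?_⟩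
  have hy : f (Pi.single i 1) = y i := by simp [f]
  have hz : g (Pi.single i 1) = z i := by simp [g]
  let x : LinearMap.range f := ⟨y i, Pi.single i 1, hy⟩
  have h1 : L.extend (y i) = L x := L.extend_apply x
  have h2 : g (s x) - g (Pi.single i 1) = 0 := by
    rw [← map_sub, ← norm_eq_zero, hfg, map_sub, hs', hy, sub_self, norm_zero]
  change L.extend (y i) = z i
  rw [h1, ← hz]
  exact sub_eq_zero.1 h2

/-- Configurations with nearly equal mutual distances are nearly congruent. -/
theorem exists_near_linearIsometryEquiv (ι : Type*) [Fintype ι] {ζ : ℝ} (hζ : 0 < ζ) :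
    ∃ δ : ℝ, 0 < δ ∧ ∀ y z : ι → E, (∀ i, ‖y i‖ ≤ 2) → (∀ i, ‖z i‖ ≤ 2) →
      (∀ i, |‖z i‖ - ‖y i‖| ≤ δ) → (∀ i j, |‖z i - z j‖ - ‖y i - y j‖| ≤ δ) →
      ∃ A : E ≃ₗᵢ[ℝ] E, ∀ i, ‖z i - A (y i)‖ ≤ ζ := by
  by_contra! H
  choose y z hy hz h0 h hA using fun n : ℕ => H (1 / ((n : ℝ) + 1)) (by positivity)
  have hK : ∀ n, (y n, z n) ∈ Metric.closedBall (0 : (ι → E) × (ι → E)) 2 := fun n => by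
    rw [mem_closedBall_zero_iff]
    exact max_le ((pi_norm_le_iff_of_nonneg (by norm_num)).2 (hy n))
      ((pi_norm_le_iff_of_nonneg (by norm_num)).2 (hz n))
  obtain ⟨⟨a, b⟩, -, φ, hφ, hlim⟩ :=
    (isCompact_closedBall (0 : (ι → E) × (ι → E)) 2).tendsto_subseq hK
  have la : ∀ i, Tendsto (fun n => y (φ n) i) atTop (𝓝 (a i)) := fun i =>
    (tendsto_pi_nhds.1 ((continuous_fst.tendsto _).comp hlim)) i
  have lb : ∀ i, Tendsto (fun n => z (φ n) i) atTop (𝓝 (b i)) := fun i =>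
    (tendsto_pi_nhds.1 ((continuous_snd.tendsto _).comp hlim)) i
  have l0 : Tendsto (fun n => 1 / ((φ n : ℝ) + 1)) atTop (𝓝 0) :=
    tendsto_one_div_add_atTop_nhds_zero_nat.comp hφ.tendsto_atTop
  have e0 : ∀ i, ‖b i‖ = ‖a i‖ := fun i => by
    have h1 := ((lb i).norm.sub (la i).norm).abs
    have h2 := le_of_tendsto_of_tendsto' h1 l0 fun n => h0 (φ n) i
    exact sub_eq_zero.1 (abs_nonpos_iff.1 h2)
  have e1 : ∀ i j, ‖b i - b j‖ = ‖a i - a j‖ := fun i j => by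
    have h1 := (((lb i).sub (lb j)).norm.sub ((la i).sub (la j)).norm).abs
    have h2 := le_of_tendsto_of_tendsto' h1 l0 fun n => h (φ n) i j
    exact sub_eq_zero.1 (abs_nonpos_iff.1 h2)
  obtain ⟨A, hAab⟩ := exists_linearIsometryEquiv_of_norm_eq e0 e1
  have hev : ∀ i, ∀ᶠ n in atTop, ‖z (φ n) i - A (y (φ n) i)‖ < ζ := fun i => by
    have h1 := ((lb i).sub ((A.continuous.tendsto _).comp (la i))).norm
    rw [hAab, sub_self, norm_zero] at h1
    exact h1.eventually_lt_const hζ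
  obtain ⟨n, hn⟩ := (eventually_all.2 hev).exists
  obtain ⟨i, hi⟩ := hA (φ n) A
  exact lt_asymm (hn i) hi

theorem exists_uniform_near_linearIsometryEquiv (n : ℕ) {ζ : ℝ} (hζ : 0 < ζ) :
    ∃ δ : ℝ, 0 < δ ∧ ∀ k ≤ n, ∀ y z : Fin k → E, (∀ i, ‖y i‖ ≤ 2) → (∀ i, ‖z i‖ ≤ 2) →
      (∀ i, |‖z i‖ - ‖y i‖| ≤ δ) → (∀ i j, |‖z i - z j‖ - ‖y i - y j‖| ≤ δ) →
      ∃ A : E ≃ₗᵢ[ℝ] E, ∀ i, ‖z i - A (y i)‖ ≤ ζ := by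
  choose δ hδ H using fun k : ℕ => exists_near_linearIsometryEquiv (E := E) (Fin k) hζ
  have hne : (Finset.range (n + 1)).Nonempty := by simp
  refine ⟨(Finset.range (n + 1)).inf' hne δ, (Finset.lt_inf'_iff hne).2 fun k _ => hδ k, ?_⟩
  intro k hk y z hy hz h0 h
  have hle : (Finset.range (n + 1)).inf' hne δ ≤ δ k :=
    Finset.inf'_le _ (Finset.mem_range.2 (by omega))
  exact H k y z hy hz (fun i => (h0 i).trans hle) fun i j => (h i j).trans hle

end NearIsometry

/-! ### Moving separated points slightly -/

section Correction

variable {E : Type*} [NormedAddCommGroup E] [InnerProductSpace ℝ E] [FiniteDimensional ℝ E]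

theorem exists_bump_bounded_fderiv :
    ∃ (φ : E → ℝ) (M : ℝ), 0 < M ∧ ContDiff ℝ ∞ φ ∧ φ 0 = 1 ∧ (∀ x, 1 ≤ ‖x‖ → φ x = 0) ∧
      ∀ x, ‖fderiv ℝ φ x‖ ≤ M := by
  let b : ContDiffBump (0 : E) := ⟨1 / 2, 1, by norm_num, by norm_num⟩
  have hs : ContDiff ℝ ∞ b := b.contDiff
  have hc : Continuous (fderiv ℝ b) := hs.continuous_fderiv (by simp)
  obtain ⟨M, hM⟩ := hc.bounded_above_of_compact_support (b.hasCompactSupport.fderiv ℝ)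
  refine ⟨b, max M 1, by positivity, hs, b.one_of_mem_closedBall (by simp [b]), fun x hx => ?_,
    fun x => (hM x).trans (le_max_left _ _)⟩
  exact b.zero_of_le_dist (by simpa using hx)

theorem exists_diffeomorph_local_translations {c : ℝ} (hc : 1 < c) {s : ℝ} (hs : 0 < s) (n : ℕ) :
    ∃ ζ : ℝ, 0 < ζ ∧ ∀ k ≤ n, ∀ (p q : Fin k → E) (d : ℝ), 0 < d →
      (∀ i j, i ≠ j → s * d ≤ ‖p i - p j‖) → (∀ i, ‖q i - p i‖ ≤ ζ * d) →
      ∃ Φ : E ≃ₘ[ℝ] E, DerivBilipschitz c Φ ∧ (∀ i, Φ (p i) = q i) ∧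
        ∀ x, (∀ i, s * d ≤ ‖x - p i‖) → Φ x = x := by
  obtain ⟨φ, M, hM0, hφ, hφ0, hφ1, hφM⟩ := exists_bump_bounded_fderiv (E := E)
  have hc' : c⁻¹ < 1 := inv_lt_one_of_one_lt₀ hc
  have hc0 : 0 < c⁻¹ := by positivity
  have hc1 : 0 < 1 - c⁻¹ := by linarith
  -- The bumps have radius s d, the separation itself, so their supports may overlap. The factor n +
  -- 1 bounds the sum of at most n gradients by 1 - c⁻¹.
  refine ⟨(1 - c⁻¹) * s / ((n + 1) * M), by positivity, ?_⟩
  intro k hk p q d hd hp hq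
  set r := s * d with hr
  have hr0 : 0 < r := by positivity
  have hφr : ∀ x, r ≤ ‖x‖ → φ (r⁻¹ • x) = 0 := fun x hx => hφ1 _ (by
    rw [norm_smul, norm_inv, Real.norm_of_nonneg hr0.le, ← div_eq_inv_mul, one_le_div hr0]
    exact hx)
  let h : E → E := fun x => ∑ i, φ (r⁻¹ • (x - p i)) • (q i - p i)
  have hcomp : ∀ i, ContDiff ℝ ∞ fun x => φ (r⁻¹ • (x - p i)) := fun i =>
    hφ.comp (contDiff_const.smul (contDiff_id.sub contDiff_const))
  have hsmooth : ContDiff ℝ ∞ h := ContDiff.sum fun i _ => (hcomp i).smul contDiff_const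
  have hder : ∀ x, ‖fderiv ℝ h x‖ ≤ 1 - c⁻¹ := fun x => by
    have h1 : ∀ i, HasFDerivAt (fun x => φ (r⁻¹ • (x - p i)) • (q i - p i))
        (((fderiv ℝ φ (r⁻¹ • (x - p i))).comp (r⁻¹ • ContinuousLinearMap.id ℝ E)).smulRight
          (q i - p i)) x := fun i => by
      have e1 : HasFDerivAt (fun x => r⁻¹ • (x - p i)) (r⁻¹ • ContinuousLinearMap.id ℝ E) x :=
        ((hasFDerivAt_id x).sub_const (p i)).const_smul r⁻¹
      have e2 := (hφ.differentiable (by simp) (r⁻¹ • (x - p i))).hasFDerivAt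
      exact (e2.comp x e1).smul_const (q i - p i)
    have h2 : fderiv ℝ h x = _ := (HasFDerivAt.fun_sum fun i (_ : i ∈ Finset.univ) => h1 i).fderiv
    rw [h2]
    have h3 : ∀ i ∈ (Finset.univ : Finset (Fin k)),
        ‖((fderiv ℝ φ (r⁻¹ • (x - p i))).comp (r⁻¹ • ContinuousLinearMap.id ℝ E)).smulRight
          (q i - p i)‖ ≤ (1 - c⁻¹) / (n + 1) := fun i _ => by
      rw [ContinuousLinearMap.norm_smulRight_apply, ContinuousLinearMap.comp_smul,
        ContinuousLinearMap.comp_id, norm_smul, norm_inv, Real.norm_of_nonneg hr0.le]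
      calc _ ≤ r⁻¹ * M * ((1 - c⁻¹) * s / ((n + 1) * M) * d) := by
            gcongr
            · exact hφM _
            · exact hq i
        _ = _ := by rw [hr]; field_simp
    refine (norm_sum_le_of_le _ h3).trans ?_
    rw [Finset.sum_const, Finset.card_univ, Fintype.card_fin, nsmul_eq_mul, ← mul_div_assoc,
      div_le_iff₀ (by positivity), mul_comm]
    gcongr
    exact_mod_cast hk.trans (Nat.le_succ n)
  obtain ⟨Φ, hΦ, hb⟩ := exists_diffeomorph_id_add hsmooth hc1.le (by linarith) hder
  refine ⟨Φ, by simpa using hb, fun i => ?_, fun x hx => ?_⟩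
  · rw [hΦ]
    have : h (p i) = q i - p i := by
      simp only [h]
      rw [Finset.sum_eq_single i]
      · simp [hφ0]
      · intro j _ hj
        rw [hφr _ (hp i j hj.symm), zero_smul]
      · simp
    rw [this, add_sub_cancel]
  · rw [hΦ]
    have : h x = 0 := Finset.sum_eq_zero fun i _ => by rw [hφr _ (hx i), zero_smul]
    rw [this, add_zero]

end Correction

/-! ### Rotation followed by correction -/

section Interpolation

variable {E : Type*} [NormedAddCommGroup E] [InnerProductSpace ℝ E] [FiniteDimensional ℝ E]

/-- The order of quantifiers matters: N depends on c and E but not on the separation s, so s may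
later be a power of a λ chosen after N. The exponent counts one factor c per dimension for the
isometry and one for the correction. -/
theorem exists_diffeomorph_interpolating {c : ℝ} (hc : 1 < c) :
    ∃ N : ℝ, 2 ≤ N ∧ ∀ s : ℝ, 0 < s → s ≤ 1 → ∃ δ : ℝ, 0 < δ ∧ δ ≤ 1 ∧
      ∀ k ≤ Module.finrank ℝ E, ∀ (y z : Fin k → E) (i₀ : Fin k) (d : ℝ), 0 < d →
        y i₀ = 0 → z i₀ = 0 → (∀ i j, ‖y i - y j‖ ≤ d) →
        (∀ i j, i ≠ j → s * d ≤ ‖y i - y j‖) →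
        (∀ i j, |‖z i - z j‖ - ‖y i - y j‖| ≤ δ * d) →
        ∃ Φ : E ≃ₘ[ℝ] E, DerivBilipschitz (c ^ (Module.finrank ℝ E + 1)) Φ ∧
          (∀ i, Φ (y i) = z i) ∧ ∀ x, N * d ≤ ‖x‖ → Φ x = x := by
  obtain ⟨Λ, hΛ, hreal⟩ := IsRealizable.exists_or_mul_reflection (E := E) hc
  -- The 2 covers the correction: its bumps have radius s d ≤ d around points of norm at most d.
  refine ⟨max Λ 2, le_max_right _ _, fun s hs0 hs1 => ?_⟩
  obtain ⟨ζ, hζ, hcorr⟩ := exists_diffeomorph_local_translations (E := E) hc hs0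
    (Module.finrank ℝ E)
  obtain ⟨δ, hδ, hnear⟩ := exists_uniform_near_linearIsometryEquiv (E := E)
    (Module.finrank ℝ E) hζ
  -- The cap at 1 keeps ‖z i‖ ≤ 2 d, inside the ball used for compactness after rescaling by d.
  refine ⟨min δ 1, by positivity, min_le_right _ _, ?_⟩
  intro k hk y z i₀ d hd hy0 hz0 hyd hys hzy
  have hyn : ∀ i, ‖y i‖ ≤ d := fun i => by simpa [hy0] using hyd i i₀
  have hzyn : ∀ i, |‖z i‖ - ‖y i‖| ≤ min δ 1 * d := fun i => by
    simpa [hy0, hz0] using hzy i i₀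
  have hzn : ∀ i, ‖z i‖ ≤ 2 * d := fun i => by
    have h1 := (le_abs_self _).trans (hzyn i)
    have h2 : min δ 1 * d ≤ 1 * d := by gcongr; exact min_le_right _ _
    linarith [hyn i]
  have scale : ∀ a b : ℝ, |a - b| ≤ min δ 1 * d → |d⁻¹ * a - d⁻¹ * b| ≤ δ := fun a b hab => by
    rw [← mul_sub, abs_mul, abs_of_pos (inv_pos.2 hd), inv_mul_le_iff₀ hd, mul_comm]
    refine hab.trans ?_
    gcongr
    exact min_le_left _ _
  have hnorm : ∀ v : E, ‖d⁻¹ • v‖ = d⁻¹ * ‖v‖ := fun v => by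
    rw [norm_smul, Real.norm_of_nonneg (by positivity)]
  obtain ⟨A, hA⟩ := hnear k hk (fun i => d⁻¹ • y i) (fun i => d⁻¹ • z i)
    (fun i => by rw [hnorm, inv_mul_le_iff₀ hd]; linarith [hyn i])
    (fun i => by rw [hnorm, inv_mul_le_iff₀ hd]; linarith [hzn i])
    (fun i => by rw [hnorm, hnorm]; exact scale _ _ (hzyn i))
    (fun i j => by rw [← smul_sub, ← smul_sub, hnorm, hnorm]; exact scale _ _ (hzy i j))
  have hA' : ∀ i, ‖z i - A (y i)‖ ≤ ζ * d := fun i => by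
    have := hA i
    rwa [map_smul, ← smul_sub, hnorm, inv_mul_le_iff₀ hd, mul_comm] at this
  obtain ⟨e, he0, he⟩ := exists_ne_zero_orthogonal hk hy0
  obtain ⟨B, hB, hBA⟩ : ∃ B : E ≃ₗᵢ[ℝ] E, IsRealizable (c ^ Module.finrank ℝ E) Λ B ∧
      ∀ i, B (y i) = A (y i) := by
    rcases hreal e he0 A with h | h
    · exact ⟨A, h, fun _ => rfl⟩
    · refine ⟨_, h, fun i => ?_⟩
      rw [LinearIsometryEquiv.coe_mul, Function.comp_apply,
        reflection_orthogonal_singleton_apply, he i]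
      simp
  obtain ⟨Φ, hΦ1, hΦ2, hΦ3⟩ := hB d hd
  obtain ⟨Ψ, hΨ1, hΨ2, hΨ3⟩ := hcorr k hk (fun i => A (y i)) z d hd
    (fun i j hij => by rw [← map_sub, LinearIsometryEquiv.norm_map]; exact hys i j hij) hA'
  refine ⟨Φ.trans Ψ, ?_, fun i => ?_, fun x hx => ?_⟩
  · rw [Diffeomorph.coe_trans, pow_succ']
    exact hΨ1.comp (by positivity) hΦ1 (Ψ.contDiff.differentiable (by simp))
      (Φ.contDiff.differentiable (by simp))
  · rw [Diffeomorph.coe_trans, Function.comp_apply, hΦ2 _ (hyn i), hBA, hΨ2]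
  · have h1 : Λ * d ≤ ‖x‖ := le_trans (by gcongr; exact le_max_left _ _) hx
    have h2 : 2 * d ≤ ‖x‖ := le_trans (by gcongr; exact le_max_right _ _) hx
    rw [Diffeomorph.coe_trans, Function.comp_apply, hΦ3 x h1]
    refine hΨ3 x fun i => ?_
    have h3 := norm_sub_norm_le x (A (y i))
    rw [LinearIsometryEquiv.norm_map] at h3
    have h4 : s * d ≤ 1 * d := by gcongr
    linarith [hyn i]

end Interpolation

/-! ### From derivative bounds to matrix inequalities -/

section Distorted

variable {D : ℕ}

open Matrix

theorem jacobianMatrix_mulVec (f : EuclideanSpace ℝ (Fin D) → EuclideanSpace ℝ (Fin D))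
    (x : EuclideanSpace ℝ (Fin D)) (v : Fin D → ℝ) :
    jacobianMatrix f x *ᵥ v = WithLp.ofLp (fderiv ℝ f x (WithLp.toLp 2 v)) := by
  have hv : WithLp.toLp 2 v = ∑ j, v j • EuclideanSpace.single j (1 : ℝ) := by
    ext i
    simp [Finset.sum_apply, Pi.single_apply]
  ext i
  rw [hv, map_sum]
  simp [jacobianMatrix, mulVec, dotProduct, Finset.sum_apply, mul_comm]

theorem dotProduct_jacobianMatrix_gram
    (f : EuclideanSpace ℝ (Fin D) → EuclideanSpace ℝ (Fin D)) (x : EuclideanSpace ℝ (Fin D))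
    (v : Fin D → ℝ) :
    v ⬝ᵥ (((jacobianMatrix f x).transpose * jacobianMatrix f x) *ᵥ v) =
      ‖fderiv ℝ f x (WithLp.toLp 2 v)‖ ^ 2 := by
  rw [← mulVec_mulVec, dotProduct_mulVec, vecMul_transpose, jacobianMatrix_mulVec,
    EuclideanSpace.real_norm_sq_eq]
  simp [dotProduct, sq]

theorem DerivBilipschitz.isDistorted {ε c : ℝ} (hc : 0 < c) (hcε : c ^ 2 = 1 + ε)
    {Φ : EuclideanSpace ℝ (Fin D) ≃ₘ[ℝ] EuclideanSpace ℝ (Fin D)} (hΦ : DerivBilipschitz c Φ) :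
    IsDistorted ε Φ := by
  intro x
  have hsymm : ((jacobianMatrix Φ x).transpose * jacobianMatrix Φ x).IsHermitian := by
    simpa using isHermitian_conjTranspose_mul_self (jacobianMatrix Φ x)
  have hone : ∀ a : ℝ, (a • (1 : Matrix (Fin D) (Fin D) ℝ)).IsHermitian := fun a => by
    simp [IsHermitian]
  have hdot : ∀ (a : ℝ) (v : Fin D → ℝ), v ⬝ᵥ ((a • (1 : Matrix (Fin D) (Fin D) ℝ)) *ᵥ v) =
      a * ‖(WithLp.toLp 2 v : EuclideanSpace ℝ (Fin D))‖ ^ 2 := fun a v => by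
    rw [smul_mulVec, one_mulVec, dotProduct_smul, EuclideanSpace.real_norm_sq_eq]
    simp [dotProduct, sq]
  rw [← hcε, Matrix.le_iff, Matrix.le_iff]
  constructor
  · refine PosSemidef.of_dotProduct_mulVec_nonneg (hsymm.sub (hone _)) fun v => ?_
    rw [star_trivial, sub_mulVec, dotProduct_sub, dotProduct_jacobianMatrix_gram, hdot, sub_nonneg,
      ← inv_pow, ← mul_pow]
    have := (hΦ x (WithLp.toLp 2 v)).1
    gcongr
  · refine PosSemidef.of_dotProduct_mulVec_nonneg ((hone _).sub hsymm) fun v => ?_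
    rw [star_trivial, sub_mulVec, dotProduct_sub, dotProduct_jacobianMatrix_gram, hdot, sub_nonneg,
      ← mul_pow]
    have := (hΦ x (WithLp.toLp 2 v)).2
    gcongr

end Distorted

/-! ### The choice of constants -/

theorem theoremt (D : ℕ) :
    ∃ C : ℝ, 0 < C ∧
      ∀ ε : ℝ, 0 < ε → ε < C →
      ∀ m : ℕ, 1 ≤ m →
      ∃ lam₀ : ℝ, 0 < lam₀ ∧
      ∀ lam : ℝ, 0 < lam → lam < lam₀ →
      ∃ δ₀ : ℝ, 0 < δ₀ ∧
      ∀ δ : ℝ, 0 < δ → δ < δ₀ →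
      ∀ (k : ℕ) (hk : 1 ≤ k), k ≤ D →
      ∀ y z : Fin k → EuclideanSpace ℝ (Fin D),
        Function.Injective y → Function.Injective z →
        y ⟨0, hk⟩ = z ⟨0, hk⟩ →
        (∀ i j : Fin k, i ≠ j → lam ^ m * Metric.diam (Set.range y) ≤ ‖y i - y j‖) →
        (∀ i j : Fin k, i ≠ j →
          (1 + δ)⁻¹ ≤ ‖z i - z j‖ / ‖y i - y j‖ ∧ ‖z i - z j‖ / ‖y i - y j‖ ≤ 1 + δ) →
        ∃ Φ : EuclideanSpace ℝ (Fin D) ≃ₘ[ℝ] EuclideanSpace ℝ (Fin D),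
          IsDistorted ε Φ ∧
          (∀ i : Fin k, Φ (y i) = z i) ∧
          ∀ x : EuclideanSpace ℝ (Fin D),
            lam ^ (-(1 / 2) : ℝ) * Metric.diam (Set.range y) ≤ ‖x - y ⟨0, hk⟩‖ → Φ x = x := by
  refine ⟨1, one_pos, fun ε hε _ m _ => ?_⟩
  -- The total distortion of norms is c ^ (D + 1), and the matrix inequality involves its square,
  -- which must equal 1 + ε.
  set c : ℝ := (1 + ε) ^ (((2 * (D + 1) : ℕ) : ℝ)⁻¹) with hcdef
  have hc : 1 < c := Real.one_lt_rpow (by linarith) (by positivity)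
  have hcε : (c ^ (D + 1)) ^ 2 = 1 + ε := by
    rw [← pow_mul, mul_comm, hcdef, Real.rpow_inv_natCast_pow (by linarith) (by omega)]
  obtain ⟨N, hN, H⟩ := exists_diffeomorph_interpolating (E := EuclideanSpace ℝ (Fin D)) hc
  simp only [finrank_euclideanSpace, Fintype.card_fin] at H
  have hN0 : 0 < N := by linarith
  have hN1 : (N ^ 2)⁻¹ ≤ 1 := inv_le_one_of_one_le₀ (by nlinarith)
  -- This threshold is exactly what gives N ≤ λ^(-1/2).
  refine ⟨(N ^ 2)⁻¹, by positivity, fun lam hl0 hl => ?_⟩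
  have hNl : N ≤ lam ^ (-(1 / 2) : ℝ) := by
    rw [Real.rpow_neg hl0.le, ← Real.sqrt_eq_rpow, le_inv_comm₀ hN0 (Real.sqrt_pos.2 hl0),
      Real.sqrt_le_left (by positivity), inv_pow]
    exact hl.le
  obtain ⟨δ₀, hδ₀, -, H⟩ := H (lam ^ m) (by positivity) (pow_le_one₀ hl0.le (hl.le.trans hN1))
  refine ⟨δ₀, hδ₀, fun δ hδ hδδ k hk hkD y z hy hz hyz hsep hrat => ?_⟩
  set i₀ : Fin k := ⟨0, hk⟩
  set d := Metric.diam (Set.range y) with hd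
  have hyd : ∀ i j, ‖y i - y j‖ ≤ d := fun i j => by
    rw [← dist_eq_norm]
    exact Metric.dist_le_diam_of_mem (Set.finite_range y).isBounded ⟨i, rfl⟩ ⟨j, rfl⟩
  -- Diameter zero means a single point, where rescaling by d is impossible but the identity works.
  by_cases hd0 : d = 0
  · have hi : ∀ i, i = i₀ := fun i => hy (by
      have := hyd i i₀
      rw [hd0, norm_le_zero_iff] at this
      exact sub_eq_zero.1 this)
    refine ⟨Diffeomorph.refl _ _ _, ?_, fun i => ?_, fun x _ => rfl⟩
    · have h1 : DerivBilipschitz (c ^ (D + 1))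
          (Diffeomorph.refl (modelWithCornersSelf ℝ (EuclideanSpace ℝ (Fin D)))
            (EuclideanSpace ℝ (Fin D)) ∞) :=
        DerivBilipschitz.id.mono one_pos (one_le_pow₀ hc.le)
      exact h1.isDistorted (pow_pos (one_pos.trans hc) _) hcε
    · rw [hi i]
      exact hyz
  have hdpos : 0 < d := lt_of_le_of_ne Metric.diam_nonneg (Ne.symm hd0)
  have hdist : ∀ i j, |‖z i - z j‖ - ‖y i - y j‖| ≤ δ₀ * d := fun i j => by
    by_cases hij : i = j
    · subst hij
      simp only [sub_self, norm_zero, abs_zero]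
      positivity
    · have hn : 0 < ‖y i - y j‖ := norm_pos_iff.2 (sub_ne_zero.2 (hy.ne hij))
      obtain ⟨h1, h2⟩ := hrat i j hij
      rw [le_div_iff₀ hn] at h1
      rw [div_le_iff₀ hn] at h2
      have h3 : 1 - δ ≤ (1 + δ)⁻¹ := by
        rw [← one_div, le_div_iff₀ (by linarith)]
        nlinarith
      have h4 : (1 - δ) * ‖y i - y j‖ ≤ ‖z i - z j‖ := le_trans (by gcongr) h1
      have h5 : δ * ‖y i - y j‖ ≤ δ₀ * d := by
        gcongr
        exact hyd i j
      rw [abs_le]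
      constructor <;> linarith
  obtain ⟨Φ, hΦ1, hΦ2, hΦ3⟩ := H k hkD (fun i => y i - y i₀) (fun i => z i - z i₀) i₀ d hdpos
    (sub_self _) (sub_self _) (fun i j => by simpa using hyd i j)
    (fun i j hij => by simpa using hsep i j hij) (fun i j => by simpa using hdist i j)
  obtain ⟨Ψ, hΨ1, hΨ2⟩ := exists_diffeomorph_conj_translation Φ hΦ1 (y i₀)
  refine ⟨Ψ, hΨ1.isDistorted (pow_pos (one_pos.trans hc) _) hcε, fun i => ?_, fun x hx => ?_⟩
  · rw [hΨ2, hΦ2, hyz, sub_add_cancel]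
  · rw [hΨ2, hΦ3 _ (le_trans (by gcongr) hx), sub_add_cancel]
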